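/- Let $\mathcal{Y}_n$ be the set of rooted planar binary trees with $n$ interior nodes (hence $n+1$ leaves) and let $\mathcal{Y}_\infty=\bigsqcup_{n\ge 0}\mathcal{Y}_n$. Write $|$ for the tree with no interior node, and $s\vee t$ for the tree whose root has left subtree $s$ and right subtree $t$. Let $s\backslash t$ be the tree obtained by adjoining the root of $t$ to the end of the rightmost branch of $s$; that is, $|\backslash t=t$ and $(s_l\vee s_r)\backslash t=s_l\vee(s_r\backslash t)$. The Tamari order on $\mathcal{Y}_n$ is the partial order whose cover relations replace a subtree of the form $(a\vee b)\vee c$ (at any node) by $a\vee(b\vee c)$, the latter tree being the larger; let $\mu_{\mathcal{Y}_n}$ be its Möbius function. Let $\mathcal{Y}\mathrm{Sym}$ be the $\mathbb{Q}$-vector space with basis $\{F_t\mid t\in\mathcal{Y}_\infty\}$. Its coproduct is the linear map $\Delta:\mathcal{Y}\mathrm{Sym}\to\mathcal{Y}\mathrm{Sym}\otimes\mathcal{Y}\mathrm{Sym}$ given by $\Delta(F_t)=\sum_{t\to(t_0,t_1)}F_{t_0}\otimes F_{t_1}$. The sum has one term for each leaf of $t$, where $t_0$ and $t_1$ are the pieces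 to the left and to the right when $t$ is divided along the path from that leaf to the root. Recursively, $|\to(|,|)$, and for $t=l\vee r$ the divisions are $t\to(l_0,\,l_1\vee r)$ for $l\to(l_0,l_1)$, and $t\to(l\vee r_0,\,r_1)$ for $r\to(r_0,r_1)$. For $t\in\mathcal{Y}_n$ put $$M_t=\sum_{s\in\mathcal{Y}_n,\ t\le s}\mu_{\mathcal{Y}_n}(t,s)\,F_s .$$ **Theorem.** For every $n\ge 0$ and every $r\in\mathcal{Y}_n$, $$\Delta(M_r)=\sum_{r=s\backslash t}M_s\otimes M_t ,$$ where the sum runs over all pairs $(s,t)\in\mathcal{Y}_\infty\times\mathcal{Y}_\infty$ with $r=s\backslash t$ (including $s=|$ and $t=|$). -/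

import Mathlib

open scoped TensorProduct

namespace YSym

/-! Rooted planar binary trees are terms of `BinaryTree Unit`: `nil` is the tree `|` without
interior nodes, and `node () s t` is the tree `s ∨ t`. The disjoint union of the sets `Y n` over
all `n` is the type `BinaryTree Unit` itself. -/

/-- Planar binary trees with `n` interior nodes (and so `n + 1` leaves). -/
def Y (n : ℕ) : Type := {t : BinaryTree Unit // t.numNodes = n}

/-- The tree `s ∨ t`, whose root has left subtree `s` and right subtree `t`. -/
abbrev graft (s t : BinaryTree Unit) : BinaryTree Unit := .node () s t

/-- `under s t` is `s \ t`: the root of `t` is adjoined to the end (the rightmost leaf) of the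
rightmost branch of `s`. -/
def under : BinaryTree Unit → BinaryTree Unit → BinaryTree Unit
  | .nil, t => t
  | .node _ l r, t => graft l (under r t)

/-- `Rotation s t`: the tree `t` arises from `s` by moving one child node directly above some node
from the left branch to the right branch above that node. -/
inductive Rotation : BinaryTree Unit → BinaryTree Unit → Prop
  | root (a b c : BinaryTree Unit) : Rotation (graft (graft a b) c) (graft a (graft b c))
  | left {l l' : BinaryTree Unit} (r : BinaryTree Unit) (h : Rotation l l') :
      Rotation (graft l r) (graft l' r)
  | right (l : BinaryTree Unit) {r r' : BinaryTree Unit} (h : Rotation r r') :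
      Rotation (graft l r) (graft l r')

theorem Rotation.numNodes_eq {s t : BinaryTree Unit} (h : Rotation s t) :
    s.numNodes = t.numNodes := by
  induction h with
  | root a b c => simp only [BinaryTree.numNodes]; omega
  | left r _ ih => simp only [BinaryTree.numNodes]; omega
  | right l _ ih => simp only [BinaryTree.numNodes]; omega

/-- Auxiliary statistic that grows along rotations; it serves only to prove antisymmetry. -/
def weight : BinaryTree Unit → ℕ
  | .nil => 0
  | .node _ l r => weight l + weight r + r.numNodes

theorem Rotation.weight_lt {s t : BinaryTree Unit} (h : Rotation s t) : weight s < weight t := by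
  induction h with
  | root a b c => simp only [weight, BinaryTree.numNodes]; omega
  | left r _ ih => simp only [weight]; omega
  | right l h ih =>
    have := h.numNodes_eq
    simp only [weight]; omega

theorem weight_le {s t : BinaryTree Unit} (h : Relation.ReflTransGen Rotation s t) :
    s = t ∨ weight s < weight t := by
  induction h with
  | refl => exact Or.inl rfl
  | tail _ h ih =>
    have := h.weight_lt
    rcases ih with rfl | ih
    · exact Or.inr this
    · exact Or.inr (ih.trans this)

/-- The Tamari order on `Y n`: the reflexive and transitive closure of rotation. -/
instance (n : ℕ) : PartialOrder (Y n) where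
  le s t := Relation.ReflTransGen Rotation s.1 t.1
  le_refl _ := Relation.ReflTransGen.refl
  le_trans _ _ _ := Relation.ReflTransGen.trans
  le_antisymm s t h h' := by
    rcases weight_le h with e | e
    · exact Subtype.ext e
    · rcases weight_le h' with e' | e'
      · exact Subtype.ext e'.symm
      · omega

instance (n : ℕ) : Fintype (Y n) :=
  Fintype.subtype (BinaryTree.treesOfNumNodesEq n) fun _ => BinaryTree.mem_treesOfNumNodesEq

instance (n : ℕ) : DecidableEq (Y n) := inferInstanceAs (DecidableEq (Subtype _))

open Classical in
noncomputable instance (n : ℕ) : LocallyFiniteOrder (Y n) := Fintype.toLocallyFiniteOrder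

/-- All ways `t → (t₀, t₁)` of dividing `t` along the path from a leaf to the root, with one entry
for each leaf of `t`, in order from left to right. If the leaf lies in the left subtree `l` of
`l ∨ r`, the root node and `r` go to the right piece; if it lies in `r`, the root node and `l` go
to the left piece. -/
def splits : BinaryTree Unit → List (BinaryTree Unit × BinaryTree Unit)
  | .nil => [(.nil, .nil)]
  | .node _ l r =>
      (splits l).map (fun p => (p.1, graft p.2 r)) ++ (splits r).map (fun p => (graft l p.1, p.2))

theorem length_splits (t : BinaryTree Unit) : (splits t).length = t.numLeaves := by
  induction t with
  | nil => rfl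
  | node _ l r hl hr => simp [splits, hl, hr]

end YSym

/-- The vector space over `ℚ` with basis the planar binary trees. -/
abbrev YSym : Type := BinaryTree Unit →₀ ℚ

namespace YSym

/-- The fundamental basis. -/
noncomputable def F (t : BinaryTree Unit) : YSym := Finsupp.single t 1

/-- The coproduct: the linear map with `Δ (F t) = ∑ F t₀ ⊗ F t₁`, the sum being over all divisions
`t → (t₀, t₁)` of `t` at a leaf. -/
noncomputable def Δ : YSym →ₗ[ℚ] YSym ⊗[ℚ] YSym :=
  Finsupp.linearCombination ℚ fun t => ((splits t).map fun p => F p.1 ⊗ₜ[ℚ] F p.2).sum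

theorem Δ_F (t : BinaryTree Unit) :
    Δ (F t) = ((splits t).map fun p => F p.1 ⊗ₜ[ℚ] F p.2).sum := by
  simp [Δ, F]

open Classical in
/-- The monomial basis: `M t = ∑ μ(t, s) F s` over the `s ≥ t` in the Tamari order, with `μ` the
Möbius function of the poset `Y n`, for `t ∈ Y n`. -/
noncomputable def M {n : ℕ} (t : Y n) : YSym :=
  ∑ s : Y n with t ≤ s, IncidenceAlgebra.mu ℚ t s • F s.1

/-- A tree as an element of `Y n`, for `n` its number of interior nodes. -/
def toY (t : BinaryTree Unit) : Y t.numNodes := ⟨t, rfl⟩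

theorem numNodes_under (s t : BinaryTree Unit) :
    (under s t).numNodes = s.numNodes + t.numNodes := by
  induction s with
  | nil => simp [under]
  | node _ l r _ ih => simp only [under, BinaryTree.numNodes, ih]; omega

theorem finite_decompositions (r : BinaryTree Unit) :
    {p : BinaryTree Unit × BinaryTree Unit | r = under p.1 p.2}.Finite := by
  let A : Finset (BinaryTree Unit) :=
    (Finset.range (r.numNodes + 1)).biUnion BinaryTree.treesOfNumNodesEq
  refine (A ×ˢ A).finite_toSet.subset ?_
  rintro ⟨s, t⟩ (h : r = under s t)
  have := numNodes_under s t
  simp only [Finset.mem_coe, Finset.mem_product, A, Finset.mem_biUnion, Finset.mem_range,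
    BinaryTree.mem_treesOfNumNodesEq, h]
  exact ⟨⟨s.numNodes, by omega, rfl⟩, ⟨t.numNodes, by omega, rfl⟩⟩

/-- The finite set of all decompositions `r = s \ t`, as pairs `(s, t)`. -/
noncomputable def decompositions (r : BinaryTree Unit) :
    Finset (BinaryTree Unit × BinaryTree Unit) :=
  (finite_decompositions r).toFinset

theorem mem_decompositions (r s t : BinaryTree Unit) :
    (s, t) ∈ decompositions r ↔ r = under s t := by
  simp [decompositions]

end YSym

namespace YSym

/-! By Möbius inversion `F t` is the sum of the `M s` over `s ≥ t` (`F_eq_sum_M`), so `Δ (F t)` is a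
sum of `M a ⊗ M b` over divisions `t → (t₀, t₁)` and pairs with `t₀ ≤ a`, `t₁ ≤ b`. By
`tamariLE_under_iff` such a division exists exactly when `t ≤ a \ b`. It is then unique, since its
left piece has as many nodes as `a` and divisions at different leaves differ in that number. Hence
`Δ (F t)` is the sum over `u ≥ t` of the claimed value of `Δ (M u)`, and a second Möbius inversion
isolates the term `u = t`. -/

/-- The Tamari order on the disjoint union of the sets `Y n`. -/
abbrev TamariLE (s t : BinaryTree Unit) : Prop := Relation.ReflTransGen Rotation s t

theorem TamariLE.numNodes_eq {s t : BinaryTree Unit} (h : TamariLE s t) :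
    s.numNodes = t.numNodes := by
  induction h with
  | refl => rfl
  | tail _ h ih => exact ih.trans h.numNodes_eq

theorem TamariLE.graft {l l' r r' : BinaryTree Unit} (hl : TamariLE l l') (hr : TamariLE r r') :
    TamariLE (graft l r) (graft l' r') :=
  (Relation.ReflTransGen.lift (fun x => YSym.graft x r) (fun _ _ h => Rotation.left r h) _ _ hl).trans
    (Relation.ReflTransGen.lift (fun x => YSym.graft l' x) (fun _ _ h => Rotation.right l' h) _ _ hr)

theorem Rotation.under_left {s s' : BinaryTree Unit} (h : Rotation s s') (t : BinaryTree Unit) :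
    Rotation (under s t) (under s' t) := by
  induction h with
  | root a b c => exact Rotation.root a b (under c t)
  | left r h _ => exact Rotation.left (under r t) h
  | right l _ ih => exact Rotation.right l ih

theorem Rotation.under_right (s : BinaryTree Unit) {t t' : BinaryTree Unit} (h : Rotation t t') :
    Rotation (under s t) (under s t') := by
  induction s with
  | nil => exact h
  | node _ l r _ ih => exact Rotation.right l ih

theorem TamariLE.under {s s' t t' : BinaryTree Unit} (hs : TamariLE s s') (ht : TamariLE t t') :
    TamariLE (under s t) (under s' t') :=
  (Relation.ReflTransGen.lift (fun x => YSym.under x t) (fun _ _ h => Rotation.under_left h t) _ _ hs).trans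
    (Relation.ReflTransGen.lift (fun x => YSym.under s' x) (fun _ _ h => Rotation.under_right s' h)
      _ _ ht)

/-- One root rotation for each node on the right branch of `x` carries `z` down to the end of that
branch. -/
theorem tamariLE_graft_under (x y z : BinaryTree Unit) :
    TamariLE (graft (under x y) z) (under x (graft y z)) := by
  induction x with
  | nil => exact .refl
  | node _ l r _ ih => exact .head (.root l (under r y) z) (TamariLE.graft .refl ih)

theorem mem_splits_graft {l r : BinaryTree Unit} {p : BinaryTree Unit × BinaryTree Unit} :
    p ∈ splits (graft l r) ↔
      (∃ q ∈ splits l, (q.1, graft q.2 r) = p) ∨ (∃ q ∈ splits r, (graft l q.1, q.2) = p) := by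
  simp only [splits, List.mem_append, List.mem_map]

theorem tamariLE_under_of_mem_splits {t : BinaryTree Unit} {p : BinaryTree Unit × BinaryTree Unit}
    (hp : p ∈ splits t) : TamariLE t (under p.1 p.2) := by
  induction t generalizing p with
  | nil =>
    obtain rfl : p = (.nil, .nil) := by simpa [splits] using hp
    exact .refl
  | node _ l r hl hr =>
    rcases mem_splits_graft.1 hp with ⟨q, hq, rfl⟩ | ⟨q, hq, rfl⟩
    · exact (TamariLE.graft (hl hq) .refl).trans (tamariLE_graft_under _ _ _)
    · exact TamariLE.graft .refl (hr hq)

theorem nil_mem_splits (t : BinaryTree Unit) : (.nil, t) ∈ splits t := by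
  induction t with
  | nil => simp [splits]
  | node _ l r hl _ => exact mem_splits_graft.2 (.inl ⟨_, hl, rfl⟩)

theorem mem_splits_under (s t : BinaryTree Unit) : (s, t) ∈ splits (under s t) := by
  induction s with
  | nil => exact nil_mem_splits t
  | node _ l r _ hr => exact mem_splits_graft.2 (.inr ⟨_, hr, rfl⟩)

/-- Divide both trees at the same leaf. Either the rotation survives inside one piece, or the path
separates its two nodes and the pieces coincide. -/
theorem Rotation.exists_mem_splits {t u : BinaryTree Unit} (h : Rotation t u)
    {q : BinaryTree Unit × BinaryTree Unit} (hq : q ∈ splits u) :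
    ∃ p ∈ splits t, TamariLE p.1 q.1 ∧ TamariLE p.2 q.2 := by
  induction h generalizing q with
  | root a b c =>
    rcases mem_splits_graft.1 hq with ⟨x, hx, rfl⟩ | ⟨y, hy, rfl⟩
    · exact ⟨_, mem_splits_graft.2 (.inl ⟨_, mem_splits_graft.2 (.inl ⟨x, hx, rfl⟩), rfl⟩),
        .refl, .single (.root _ _ _)⟩
    · rcases mem_splits_graft.1 hy with ⟨x, hx, rfl⟩ | ⟨x, hx, rfl⟩
      · exact ⟨_, mem_splits_graft.2 (.inl ⟨_, mem_splits_graft.2 (.inr ⟨x, hx, rfl⟩), rfl⟩),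
          .refl, .refl⟩
      · exact ⟨_, mem_splits_graft.2 (.inr ⟨x, hx, rfl⟩), .single (.root _ _ _), .refl⟩
  | left r h ih =>
    rcases mem_splits_graft.1 hq with ⟨x, hx, rfl⟩ | ⟨x, hx, rfl⟩
    · obtain ⟨p, hp, h₁, h₂⟩ := ih hx
      exact ⟨_, mem_splits_graft.2 (.inl ⟨p, hp, rfl⟩), h₁, TamariLE.graft h₂ .refl⟩
    · exact ⟨_, mem_splits_graft.2 (.inr ⟨x, hx, rfl⟩), TamariLE.graft (.single h) .refl, .refl⟩
  | right l h ih =>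
    rcases mem_splits_graft.1 hq with ⟨x, hx, rfl⟩ | ⟨x, hx, rfl⟩
    · exact ⟨_, mem_splits_graft.2 (.inl ⟨x, hx, rfl⟩), .refl, TamariLE.graft .refl (.single h)⟩
    · obtain ⟨p, hp, h₁, h₂⟩ := ih hx
      exact ⟨_, mem_splits_graft.2 (.inr ⟨p, hp, rfl⟩), TamariLE.graft .refl h₁, h₂⟩

theorem TamariLE.exists_mem_splits {t u : BinaryTree Unit} (h : TamariLE t u)
    {q : BinaryTree Unit × BinaryTree Unit} (hq : q ∈ splits u) :
    ∃ p ∈ splits t, TamariLE p.1 q.1 ∧ TamariLE p.2 q.2 := by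
  induction h generalizing q with
  | refl => exact ⟨q, hq, .refl, .refl⟩
  | tail _ h ih =>
    obtain ⟨p, hp, h₁, h₂⟩ := h.exists_mem_splits hq
    obtain ⟨x, hx, h₃, h₄⟩ := ih hp
    exact ⟨x, hx, h₃.trans h₁, h₄.trans h₂⟩

/-- `t ≤ a \ b` if and only if some division `t → (t₀, t₁)` has `t₀ ≤ a` and `t₁ ≤ b`. -/
theorem tamariLE_under_iff {t a b : BinaryTree Unit} :
    TamariLE t (under a b) ↔ ∃ p ∈ splits t, TamariLE p.1 a ∧ TamariLE p.2 b :=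
  ⟨fun h => h.exists_mem_splits (mem_splits_under a b), fun ⟨_, hp, h₁, h₂⟩ =>
    (tamariLE_under_of_mem_splits hp).trans (TamariLE.under h₁ h₂)⟩

theorem map_numNodes_splits (t : BinaryTree Unit) :
    (splits t).map (fun p => p.1.numNodes) = List.range (t.numNodes + 1) := by
  induction t with
  | nil => rfl
  | node _ l r hl hr =>
    -- At a leaf of `r` the left piece also contains `l` and the root, so the counts continue from
    -- `l.numNodes + 1`.
    have h₁ : (splits r).map (fun p => l.numNodes + p.1.numNodes + 1) =
        (List.range (r.numNodes + 1)).map (fun k => l.numNodes + 1 + k) := by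
      rw [← hr, List.map_map]
      exact List.map_congr_left fun p _ => by simp only [Function.comp]; omega
    have h₂ : l.numNodes + r.numNodes + 1 + 1 = (l.numNodes + 1) + (r.numNodes + 1) := by omega
    simp only [splits, List.map_append, List.map_map, Function.comp_def, BinaryTree.numNodes, hl,
      h₁, h₂]
    rw [List.range_add (n := l.numNodes + 1)]

theorem nodup_map_numNodes_splits (t : BinaryTree Unit) :
    ((splits t).map (fun p => p.1.numNodes)).Nodup := by
  rw [map_numNodes_splits]
  exact List.nodup_range

theorem eq_of_mem_splits {t : BinaryTree Unit} {p q : BinaryTree Unit × BinaryTree Unit}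
    (hp : p ∈ splits t) (hq : q ∈ splits t) (h : p.1.numNodes = q.1.numNodes) : p = q :=
  List.inj_on_of_nodup_map (nodup_map_numNodes_splits t) hp hq h

open Classical in
/-- The finite set of all trees above `t` in the Tamari order. -/
noncomputable def upperSet (t : BinaryTree Unit) : Finset (BinaryTree Unit) :=
  (BinaryTree.treesOfNumNodesEq t.numNodes).filter (TamariLE t)

theorem mem_upperSet {s t : BinaryTree Unit} : s ∈ upperSet t ↔ TamariLE t s := by
  simp only [upperSet, Finset.mem_filter, BinaryTree.mem_treesOfNumNodesEq, and_iff_right_iff_imp]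
  exact fun h => h.numNodes_eq.symm

open Classical in
theorem sum_upperSet {A : Type*} [AddCommMonoid A] {n : ℕ} (t : Y n) (f : BinaryTree Unit → A) :
    ∑ s ∈ upperSet t.1, f s = ∑ s : Y n with t ≤ s, f s.1 := by
  symm
  refine Finset.sum_nbij (fun s => s.1) (fun s hs => ?_) (fun s _ s' _ h => Subtype.ext h)
    (fun s hs => ?_) (fun _ _ => rfl)
  · exact mem_upperSet.2 (Finset.mem_filter.1 hs).2
  · have h := mem_upperSet.1 (Finset.mem_coe.1 hs)
    exact ⟨⟨s, h.numNodes_eq.symm.trans t.2⟩, Finset.mem_coe.2 (Finset.mem_filter.2 ⟨Finset.mem_univ _, h⟩), rfl⟩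

/-- The bijection sends a division `p` with a pair `(a, b)` above it to `a \ b` with the same pair;
`tamariLE_under_iff` makes it well defined and surjective. -/
theorem sum_splits_upperSet {A : Type*} [AddCommMonoid A] (t : BinaryTree Unit)
    (f : BinaryTree Unit × BinaryTree Unit → A) :
    ((splits t).map fun p => ∑ q ∈ upperSet p.1 ×ˢ upperSet p.2, f q).sum =
      ∑ u ∈ upperSet t, ∑ q ∈ decompositions u, f q := by
  rw [← List.sum_toFinset _ (nodup_map_numNodes_splits t).of_map, Finset.sum_sigma',
    Finset.sum_sigma']
  refine Finset.sum_nbij (fun x => ⟨under x.2.1 x.2.2, x.2⟩) ?_ ?_ ?_ (fun _ _ => rfl)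
  · rintro ⟨p, a, b⟩ h
    simp only [Finset.mem_sigma, List.mem_toFinset, Finset.mem_product, mem_upperSet] at h
    simp only [Finset.mem_sigma, mem_upperSet, mem_decompositions, and_true]
    exact tamariLE_under_iff.2 ⟨p, h⟩
  · rintro ⟨p, a, b⟩ h ⟨q, a', b'⟩ h' e
    simp only [Finset.mem_coe, Finset.mem_sigma, List.mem_toFinset, Finset.mem_product,
      mem_upperSet] at h h'
    obtain ⟨rfl, rfl⟩ : a = a' ∧ b = b' := by simpa using congrArg Sigma.snd e
    -- Both left pieces lie below `a`, hence have equally many nodes, and this number determines the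
    -- division.
    rw [eq_of_mem_splits h.1 h'.1 (h.2.1.numNodes_eq.trans h'.2.1.numNodes_eq.symm)]
  · rintro ⟨u, a, b⟩ h
    simp only [Finset.mem_coe, Finset.mem_sigma, mem_upperSet, mem_decompositions] at h
    obtain ⟨h, rfl⟩ := h
    obtain ⟨p, hp, h₁, h₂⟩ := tamariLE_under_iff.1 h
    exact ⟨⟨p, a, b⟩, by simp [mem_upperSet, hp, h₁, h₂], rfl⟩

section Moebius

variable {P V : Type*} [PartialOrder P] [Fintype P] [LocallyFiniteOrder P]
  [AddCommGroup V] [Module ℚ V]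

open Classical in
-- Summing over intervals on the inside lets the defining identities of `μ` collapse the double sum,
-- in both inversions below.
theorem sum_sum_le {A : Type*} [AddCommMonoid A] (t : P) (f : P → P → A) :
    ∑ s with t ≤ s, ∑ u with s ≤ u, f s u = ∑ u, ∑ s ∈ Finset.Icc t u, f s u :=
  Finset.sum_comm' fun s u => by simp

open Classical in
theorem sum_mu_smul_sum [DecidableEq P] (t : P) (G : P → V) :
    ∑ s with t ≤ s, IncidenceAlgebra.mu ℚ t s • ∑ u with s ≤ u, G u = G t := by
  simp_rw [Finset.smul_sum, sum_sum_le, ← Finset.sum_smul, IncidenceAlgebra.sum_Icc_mu_right]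
  simp

open Classical in
theorem sum_sum_mu_smul [DecidableEq P] (t : P) (G : P → V) :
    ∑ s with t ≤ s, ∑ u with s ≤ u, IncidenceAlgebra.mu ℚ s u • G u = G t := by
  simp_rw [sum_sum_le, ← Finset.sum_smul, IncidenceAlgebra.sum_Icc_mu_left]
  simp

end Moebius

theorem M_toY {n : ℕ} (t : Y n) : M (toY t.1) = M t := by
  obtain ⟨t, rfl⟩ := t
  rfl

theorem F_eq_sum_M (t : BinaryTree Unit) : F t = ∑ s ∈ upperSet t, M (toY s) := by
  refine Eq.trans ?_ (sum_upperSet (toY t) _).symm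
  simp_rw [M_toY, M]
  exact (sum_sum_mu_smul (toY t) fun s => F s.1).symm

theorem Δ_F_eq_sum_M (t : BinaryTree Unit) :
    Δ (F t) = ∑ u ∈ upperSet t, ∑ p ∈ decompositions u, M (toY p.1) ⊗ₜ[ℚ] M (toY p.2) := by
  rw [Δ_F, ← sum_splits_upperSet]
  simp_rw [F_eq_sum_M, TensorProduct.sum_tmul, TensorProduct.tmul_sum, Finset.sum_product]

end YSym

theorem theorem5p1 (n : ℕ) (r : YSym.Y n) :
    YSym.Δ (YSym.M r) =
      ∑ p ∈ YSym.decompositions r.1,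
        YSym.M (YSym.toY p.1) ⊗ₜ[ℚ] YSym.M (YSym.toY p.2) := by
  rw [YSym.M, map_sum]
  simp_rw [map_smul, YSym.Δ_F_eq_sum_M, YSym.sum_upperSet]
  exact YSym.sum_mu_smul_sum r _
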